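/- Let $\gamma$ be a Jordan arc in $\mathbb{R}^2$ (a homeomorphic image of $[0,1]$) with endpoints $a_0, a_1$; for points $x,y\in\gamma$ write $\gamma(x,y)$ for the closed subarc of $\gamma$ with endpoints $x$ and $y$. Suppose that (i) for every $\varepsilon>0$ and every non-degenerate subarc $\gamma'\subset\gamma$ (that is, $\gamma'=\gamma(x,y)$ with $x\ne y$) there is a non-degenerate (injective) affine map $S:\mathbb{R}^2\to\mathbb{R}^2$ such that $S(\gamma)\subset\gamma'$ and $\operatorname{Lip} S<\varepsilon$; (ii) there is a sequence of affine maps $f_k:\mathbb{R}^2\to\mathbb{R}^2$ converging to the identity such that, for every $k$, $f_k(a_0)\in\gamma$, $f_k(\gamma)\cap\gamma=\gamma(f_k(a_0),a_1)$, and $f_k$ has no fixed point on $\gamma$. Then $\gamma$ is a parabolic segment (a compact arc of a parabola) or a straight line segment. -/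

import Mathlib

/-- The Euclidean plane. -/
abbrev Plane : Type := EuclideanSpace ℝ (Fin 2)

/-- `γ` parametrizes a Jordan arc in the plane, with endpoints `γ 0` and `γ 1`; the arc as a point
set is `Set.range γ`. (A continuous injection of the compact interval is a homeomorphism onto its
image.) -/
structure IsJordanArc (γ : unitInterval → Plane) : Prop where
  continuous : Continuous γ
  injective : Function.Injective γ

/-- `x` and `y` are points of the arc `γ`, and `B` is the subarc `γ(x, y)` of `γ` with endpoints
`x` and `y`. It is non-degenerate when `x ≠ y`. -/
def IsSubarc (γ : unitInterval → Plane) (x y : Plane) (B : Set Plane) : Prop :=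
  ∃ s t : unitInterval, γ s = x ∧ γ t = y ∧ B = γ '' Set.uIcc s t

/-- A (non-degenerate) parabolic segment: a compact arc of a parabola. The parabolas are exactly
the images of `{(t, t ^ 2)}` under the invertible affine maps of the plane. -/
def IsParabolicSegment (A : Set Plane) : Prop :=
  ∃ (T : Plane ≃ᵃ[ℝ] Plane) (a b : ℝ), a < b ∧
    A = T '' ((fun t : ℝ => (!₂[t, t ^ 2] : Plane)) '' Set.Icc a b)

/-- A (non-degenerate) straight line segment. -/
def IsStraightSegment (A : Set Plane) : Prop :=
  ∃ x y : Plane, x ≠ y ∧ A = segment ℝ x y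

/-! In homogeneous coordinates write `f k` as `1 + E k` with `E k → 0`. Along a subsequence `E k /
‖E k‖` converges to some `A ≠ 0`, and about `t / ‖E k‖` iterates of `f k` approximate `exp (t • A)`.
Since `f k` pushes the arc along itself, iterates of a point stay on the arc until they come near
the end `γ 1`; hence the arc contains a short forward orbit of each of its other points
(`IsJordanArc.exists_orbit_subset`).

Suppose the arc is not collinear. Some such orbit is then a non-constant smooth curve. If its
velocity and acceleration were parallel at the start it would lie on a line, and an affine copy of
the arc inside it would make the arc collinear. So it is curved, and near any point close to its
start it agrees with a parabola up to third order. Affine copies of the arc fit into ever shorter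
pieces of it. Pulling back and rescaling gives quadratic relations on the arc whose errors vanish in
the limit (`IsJordanArc.exists_eq_sq`, `exists_eq_sq_of_approx`), so the arc lies on a parabola. -/

open Set Filter Topology

/-! ### Powers of operators near the identity. -/

/-- Second order Taylor bound for the exponential along a line. -/
theorem exists_norm_exp_smul_sub_le {W : Type*} [NormedRing W] [NormedAlgebra ℝ W]
    [CompleteSpace W] (A : W) :
    ∃ C δ : ℝ, 0 ≤ C ∧ 0 < δ ∧ ∀ s : ℝ, |s| ≤ δ →
      ‖NormedSpace.exp (s • A) - (1 + s • A + (s ^ 2 / 2) • A ^ 2)‖ ≤ C * |s| ^ 3 := by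
  have h := (NormedSpace.exp_hasFPowerSeriesAt_zero (𝕂 := ℝ) (𝔸 := W)).isBigO_sub_partialSum_pow 3
  have hs : Tendsto (fun s : ℝ => s • A) (𝓝 0) (𝓝 0) := by
    have : Continuous fun s : ℝ => s • A := by fun_prop
    simpa using this.tendsto 0
  obtain ⟨C, hC, hb⟩ := (h.comp_tendsto hs).exists_pos
  rw [Asymptotics.isBigOWith_iff, Metric.eventually_nhds_iff] at hb
  obtain ⟨δ, hδ, hb⟩ := hb
  refine ⟨C * ‖A‖ ^ 3, δ / 2, by positivity, by positivity, fun s hsδ => ?_⟩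
  have := hb (y := s) (by rw [Real.dist_eq, sub_zero]; linarith)
  simp only [FormalMultilinearSeries.partialSum, Finset.sum_range_succ, Finset.sum_range_zero,
    NormedSpace.expSeries_apply_eq, Function.comp] at this
  simp [smul_pow, norm_smul, mul_pow] at this
  convert this using 1
  · congr 3
    rw [smul_smul]; congr 1; ring
  · ring

theorem norm_exp_le_rexp_norm {W : Type*} [NormedRing W] [NormOneClass W] [NormedAlgebra ℝ W]
    [CompleteSpace W] (A : W) : ‖NormedSpace.exp A‖ ≤ Real.exp ‖A‖ := by
  have h := NormedSpace.expSeries_hasSum_exp (𝕂 := ℝ) A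
  have h' := NormedSpace.expSeries_hasSum_exp (𝕂 := ℝ) ‖A‖
  rw [Real.exp_eq_exp_ℝ]
  refine h.norm_le_of_bounded h' fun n => ?_
  simp only [NormedSpace.expSeries_apply_eq, norm_smul, smul_eq_mul]
  rw [Real.norm_of_nonneg (by positivity)]
  gcongr
  exact norm_pow_le _ _

/-- Powers depend Lipschitz continuously on the base. -/
theorem norm_pow_sub_pow_le_mul {W : Type*} [NormedRing W] [NormOneClass W] (X Y : W) {M : ℝ}
    (hM : 1 ≤ M) (hX : ‖X‖ ≤ M) (hY : ‖Y‖ ≤ M) (n : ℕ) :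
    ‖X ^ n - Y ^ n‖ ≤ n * M ^ n * ‖X - Y‖ := by
  induction n with
  | zero => simp
  | succ n ih =>
    have e : X ^ (n + 1) - Y ^ (n + 1) = X ^ n * (X - Y) + (X ^ n - Y ^ n) * Y := by
      rw [pow_succ, pow_succ]; noncomm_ring
    have h1 : ‖X ^ n‖ ≤ M ^ n := (norm_pow_le X n).trans (by gcongr)
    calc ‖X ^ (n + 1) - Y ^ (n + 1)‖ ≤ ‖X ^ n‖ * ‖X - Y‖ + ‖X ^ n - Y ^ n‖ * ‖Y‖ := by
          rw [e]
          exact (norm_add_le _ _).trans (add_le_add (norm_mul_le _ _) (norm_mul_le _ _))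
      _ ≤ M ^ n * ‖X - Y‖ + n * M ^ n * ‖X - Y‖ * M := by gcongr
      _ ≤ M ^ n * M * ‖X - Y‖ + n * M ^ n * ‖X - Y‖ * M := by
          gcongr
          exact le_mul_of_one_le_right (by positivity) hM
      _ = _ := by push_cast; ring

theorem norm_one_add_pow_le {W : Type*} [NormedRing W] [NormOneClass W] (E : W) (n : ℕ) :
    ‖(1 + E) ^ n‖ ≤ Real.exp (n * ‖E‖) := by
  calc ‖(1 + E) ^ n‖ ≤ ‖1 + E‖ ^ n := norm_pow_le _ _
    _ ≤ (1 + ‖E‖) ^ n := by gcongr; simpa using norm_add_le (1 : W) E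
    _ ≤ (Real.exp ‖E‖) ^ n := by gcongr; linarith [Real.add_one_le_exp ‖E‖]
    _ = _ := by rw [← Real.exp_nat_mul]

/-- Controls how far iterates of a map near the identity can drift from their starting point. -/
theorem norm_one_add_pow_sub_one_le {W : Type*} [NormedRing W] [NormOneClass W] (E : W) (n : ℕ) :
    ‖(1 + E) ^ n - 1‖ ≤ Real.exp (n * ‖E‖) - 1 := by
  have key : ‖(1 + E) ^ n - 1‖ ≤ (1 + ‖E‖) ^ n - 1 := by
    induction n with
    | zero => simp
    | succ n ih =>
      have e : (1 + E) ^ (n + 1) - 1 = ((1 + E) ^ n - 1) * (1 + E) + E := by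
        rw [pow_succ]; noncomm_ring
      have h1 : ‖1 + E‖ ≤ 1 + ‖E‖ := by simpa using norm_add_le (1 : W) E
      calc ‖(1 + E) ^ (n + 1) - 1‖ ≤ ‖(1 + E) ^ n - 1‖ * ‖1 + E‖ + ‖E‖ := by
            rw [e]; exact (norm_add_le _ _).trans (by gcongr; exact norm_mul_le _ _)
        _ ≤ ((1 + ‖E‖) ^ n - 1) * (1 + ‖E‖) + ‖E‖ := by
            gcongr
            exact (norm_nonneg _).trans ih
        _ = _ := by ring
  refine key.trans (sub_le_sub_right ?_ 1)
  rw [Real.exp_nat_mul]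
  gcongr
  linarith [Real.add_one_le_exp ‖E‖]

/-- Euler's formula: if `E k ≠ 0` tends to `0` in the direction `A`, then powers of `1 + E k`
approximate the one-parameter group generated by `A`. -/
theorem tendsto_one_add_pow_floor_exp {W : Type*} [NormedRing W] [NormOneClass W]
    [NormedAlgebra ℝ W] [CompleteSpace W] {E : ℕ → W} {A : W} (hE : ∀ k, E k ≠ 0)
    (hE0 : Tendsto (fun k => ‖E k‖) atTop (𝓝 0))
    (hA : Tendsto (fun k => ‖E k‖⁻¹ • E k) atTop (𝓝 A)) (hA1 : ‖A‖ = 1) {t : ℝ} (ht : 0 ≤ t) :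
    Tendsto (fun k => (1 + E k) ^ ⌊t / ‖E k‖⌋₊) atTop (𝓝 (NormedSpace.exp (t • A))) := by
  let _ : NormedAlgebra ℚ W := NormedAlgebra.restrictScalars ℚ ℝ W
  have hpos : ∀ k, 0 < ‖E k‖ := fun k => norm_pos_iff.2 (hE k)
  set n : ℕ → ℕ := fun k => ⌊t / ‖E k‖⌋₊ with hn
  have hnle : ∀ k, n k * ‖E k‖ ≤ t := fun k => by
    rw [← le_div_iff₀ (hpos k)]
    exact Nat.floor_le (by have := hpos k; positivity)
  have hnge : ∀ k, t - ‖E k‖ ≤ n k * ‖E k‖ := fun k => by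
    have h1 : t / ‖E k‖ < n k + 1 := Nat.lt_floor_add_one _
    rw [div_lt_iff₀ (hpos k)] at h1
    linarith
  have hnt : Tendsto (fun k => n k * ‖E k‖) atTop (𝓝 t) := by
    refine tendsto_of_tendsto_of_tendsto_of_le_of_le ?_ tendsto_const_nhds hnge hnle
    simpa using (tendsto_const_nhds (x := t)).sub hE0
  have hmain : Tendsto (fun k => NormedSpace.exp ((n k * ‖E k‖) • A)) atTop
      (𝓝 (NormedSpace.exp (t • A))) :=
    ((NormedSpace.exp_continuous (𝔸 := W)).tendsto _).comp (hnt.smul_const A)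
  obtain ⟨C, δ, hC, hδ, hexp⟩ := exists_norm_exp_smul_sub_le A
  have hdiff : Tendsto (fun k => (1 + E k) ^ n k - NormedSpace.exp ((n k * ‖E k‖) • A)) atTop
      (𝓝 0) := by
    have hbound : ∀ᶠ k in atTop, ‖(1 + E k) ^ n k - NormedSpace.exp ((n k * ‖E k‖) • A)‖ ≤
        t * Real.exp t * (‖‖E k‖⁻¹ • E k - A‖ + ‖E k‖ / 2 * ‖A ^ 2‖ + C * ‖E k‖ ^ 2) := by
      filter_upwards [hE0.eventually_le_const hδ] with k hk
      have e1 : NormedSpace.exp ((n k * ‖E k‖) • A) = (NormedSpace.exp (‖E k‖ • A)) ^ n k := by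
        rw [← NormedSpace.exp_nsmul, mul_smul, Nat.cast_smul_eq_nsmul]
      have hM : (1 : ℝ) ≤ Real.exp ‖E k‖ := Real.one_le_exp (norm_nonneg _)
      have hX : ‖1 + E k‖ ≤ Real.exp ‖E k‖ := by simpa using norm_one_add_pow_le (E k) 1
      have hY : ‖NormedSpace.exp (‖E k‖ • A)‖ ≤ Real.exp ‖E k‖ := by
        simpa [norm_smul, hA1] using norm_exp_le_rexp_norm (‖E k‖ • A)
      have h1 := norm_pow_sub_pow_le_mul _ _ hM hX hY (n k)
      have h2 := hexp ‖E k‖ (by rwa [abs_of_pos (hpos k)])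
      rw [abs_of_pos (hpos k)] at h2
      -- One step errs by `o(‖E k‖)`; since `n k ≤ t / ‖E k‖`, the accumulated error still tends to
      -- `0`.
      have h3 : ‖1 + E k - NormedSpace.exp (‖E k‖ • A)‖ ≤
          ‖E k‖ * (‖‖E k‖⁻¹ • E k - A‖ + ‖E k‖ / 2 * ‖A ^ 2‖ + C * ‖E k‖ ^ 2) := by
        have e : 1 + E k - NormedSpace.exp (‖E k‖ • A) = ‖E k‖ • (‖E k‖⁻¹ • E k - A)
            - (‖E k‖ ^ 2 / 2) • A ^ 2
            - (NormedSpace.exp (‖E k‖ • A) - (1 + ‖E k‖ • A + (‖E k‖ ^ 2 / 2) • A ^ 2)) := by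
          rw [smul_sub, smul_inv_smul₀ (hpos k).ne']; abel
        rw [e]
        refine (norm_sub_le _ _).trans ((add_le_add (norm_sub_le _ _) h2).trans ?_)
        rw [norm_smul, norm_smul, norm_norm, Real.norm_of_nonneg (by positivity)]
        apply le_of_eq; ring
      rw [e1]
      refine h1.trans ?_
      calc _ ≤ (n k : ℝ) * Real.exp ‖E k‖ ^ n k * (‖E k‖ *
            (‖‖E k‖⁻¹ • E k - A‖ + ‖E k‖ / 2 * ‖A ^ 2‖ + C * ‖E k‖ ^ 2)) := by gcongr
        _ = (n k * ‖E k‖) * Real.exp (n k * ‖E k‖) *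
            (‖‖E k‖⁻¹ • E k - A‖ + ‖E k‖ / 2 * ‖A ^ 2‖ + C * ‖E k‖ ^ 2) := by
            rw [Real.exp_nat_mul]; ring
        _ ≤ _ := by
            gcongr
            exacts [hnle k, hnle k]
    refine squeeze_zero_norm' hbound ?_
    have h1 : Tendsto (fun k => ‖‖E k‖⁻¹ • E k - A‖) atTop (𝓝 0) :=
      tendsto_iff_norm_sub_tendsto_zero.1 hA
    have h2 := ((h1.add ((hE0.div_const 2).mul_const ‖A ^ 2‖)).add
      ((hE0.pow 2).const_mul C)).const_mul (t * Real.exp t)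
    simpa using h2
  simpa using hdiff.add hmain

/-! ### Topology of the arc. -/

/-- If the part of an arc shared with an injective continuous image of it is the subarc from the
image of the initial point to the terminal point, then an initial piece of the arc is mapped into
the arc until the terminal point is hit. -/
theorem IsJordanArc.exists_map_eq_one {γ : unitInterval → Plane} (hγ : IsJordanArc γ)
    {f : Plane → Plane} (hf : Continuous f) (hinj : Function.Injective f)
    (hsub : IsSubarc γ (f (γ 0)) (γ 1) (f '' range γ ∩ range γ)) :
    ∃ z : unitInterval, f (γ z) = γ 1 ∧ ∀ s ≤ z, f (γ s) ∈ range γ := by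
  obtain ⟨u, t, hu, ht, hB⟩ := hsub
  obtain rfl := hγ.injective ht
  have hconn : IsPreconnected (f '' range γ ∩ range γ) := by
    rw [hB]
    exact isPreconnected_uIcc.image _ hγ.continuous.continuousOn
  have hc : Continuous (f ∘ γ) := hf.comp hγ.continuous
  -- The parameters sent into the arc form an interval; it contains `0` and `z`, hence everything
  -- between.
  have hJ : IsPreconnected ((f ∘ γ) ⁻¹' (f '' range γ ∩ range γ)) :=
    hconn.preimage_of_isClosedMap (hinj.comp hγ.injective) hc.isClosedMap
      (by rw [range_comp]; exact inter_subset_left)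
  have h1 : γ 1 ∈ f '' range γ ∩ range γ := hB ▸ mem_image_of_mem γ right_mem_uIcc
  have h0 : f (γ 0) ∈ f '' range γ ∩ range γ := by
    rw [← hu, hB]; exact mem_image_of_mem γ left_mem_uIcc
  obtain ⟨_, ⟨z, rfl⟩, hz⟩ := h1.1
  refine ⟨z, hz, fun s hs => ?_⟩
  have := hJ.ordConnected.out (x := 0) (y := z) h0 (by simpa [hz] using h1)
    ⟨unitInterval.nonneg', hs⟩
  exact this.2

/-- Points following a point close to the end of the arc are close to the end of the arc. -/
theorem IsJordanArc.exists_dist_lt_of_le {γ : unitInterval → Plane} (hγ : IsJordanArc γ)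
    {d : ℝ} (hd : 0 < d) :
    ∃ η > 0, ∀ z s, z ≤ s → dist (γ z) (γ 1) < η → dist (γ s) (γ 1) < d := by
  have hc := hγ.continuous
  have hcd : Continuous fun s => dist (γ s) (γ 1) := by fun_prop
  rcases (({s | d ≤ dist (γ s) (γ 1)} : Set unitInterval)).eq_empty_or_nonempty with he | hne
  · refine ⟨1, one_pos, fun z s _ _ => ?_⟩
    by_contra! h
    exact he.subset h
  -- `c` is the last parameter at distance at least `d` from the end. The minimal distance to the
  -- end over `[0, c]` serves as `η`: a point nearer than that comes after `c`.
  obtain ⟨c, hc1, hcmax⟩ := (isClosed_le continuous_const hcd).isCompact.exists_isGreatest hne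
  have hcne : c ≠ 1 := by
    rintro rfl
    simp only [mem_ofPred_eq, dist_self] at hc1
    linarith
  obtain ⟨m, hm, hmin⟩ := (isClosed_Iic (a := c)).isCompact.exists_isMinOn ⟨c, mem_Iic.2 le_rfl⟩
    hcd.continuousOn
  refine ⟨dist (γ m) (γ 1), dist_pos.2 fun h => ?_, fun z s hzs hz => ?_⟩
  · exact hcne (le_antisymm le_top ((hγ.injective h).symm.trans_le hm))
  · by_contra! h
    exact absurd (hmin (show z ∈ Iic c from hzs.trans (hcmax h))) (not_le.2 hz)

/-- A nontrivial connected subset of an arc contains a non-degenerate subarc. -/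
theorem IsJordanArc.exists_isSubarc_subset {γ : unitInterval → Plane} (hγ : IsJordanArc γ)
    {C : Set Plane} (hC : IsPreconnected C) (hCγ : C ⊆ range γ) {p q : Plane} (hp : p ∈ C)
    (hq : q ∈ C) (hpq : p ≠ q) : ∃ x y B, x ≠ y ∧ IsSubarc γ x y B ∧ B ⊆ C := by
  have hJ := hC.preimage_of_isClosedMap hγ.injective hγ.continuous.isClosedMap hCγ
  obtain ⟨s, rfl⟩ := hCγ hp
  obtain ⟨t, rfl⟩ := hCγ hq
  exact ⟨_, _, _, hpq, ⟨s, t, rfl, rfl, rfl⟩, image_subset_iff.2 (hJ.ordConnected.uIcc_subset hp hq)⟩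

theorem IsJordanArc.isCompact_range {γ : unitInterval → Plane} (hγ : IsJordanArc γ) :
    IsCompact (range γ) := _root_.isCompact_range hγ.continuous

theorem IsJordanArc.isConnected_range {γ : unitInterval → Plane} (hγ : IsJordanArc γ) :
    IsConnected (range γ) := _root_.isConnected_range hγ.continuous

/-- The image of an arc under a non-constant continuous function is a non-degenerate interval. -/
theorem IsJordanArc.exists_image_eq_Icc {γ : unitInterval → Plane} (hγ : IsJordanArc γ)
    {m : Plane → ℝ} (hm : Continuous m) {p q : Plane} (hp : p ∈ range γ) (hq : q ∈ range γ)
    (hpq : m p ≠ m q) : ∃ a b, a < b ∧ m '' range γ = Icc a b := by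
  have h := eq_Icc_of_connected_compact (hγ.isConnected_range.image m hm.continuousOn)
    (hγ.isCompact_range.image hm)
  refine ⟨_, _, ?_, h⟩
  have h1 : m p ∈ m '' range γ := mem_image_of_mem _ hp
  have h2 : m q ∈ m '' range γ := mem_image_of_mem _ hq
  rw [h] at h1 h2
  by_contra! hle
  exact hpq (by linarith [h1.1, h1.2, h2.1, h2.2])

theorem IsJordanArc.zero_ne_one {γ : unitInterval → Plane} (hγ : IsJordanArc γ) : γ 0 ≠ γ 1 :=
  fun h => _root_.zero_ne_one (hγ.injective h)

theorem IsJordanArc.isStraightSegment {γ : unitInterval → Plane} (hγ : IsJordanArc γ)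
    (h : Collinear ℝ (range γ)) : IsStraightSegment (range γ) := by
  obtain ⟨v, hv⟩ := (collinear_iff_of_mem (mem_range_self 0)).1 h
  have hv0 : v ≠ 0 := by
    rintro rfl
    obtain ⟨r, hr⟩ := hv (γ 1) (mem_range_self 1)
    exact hγ.zero_ne_one (by simpa using hr.symm)
  set g : ℝ →ᵃ[ℝ] Plane := AffineMap.lineMap (γ 0) (γ 0 + v)
  have hg : ∀ r : ℝ, g r = r • v + γ 0 := fun r => by simp [g, AffineMap.lineMap_apply]
  set m : Plane → ℝ := fun p => inner ℝ v (p - γ 0) / inner ℝ v v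
  have hvv : inner ℝ v v ≠ 0 := inner_self_ne_zero.2 hv0
  have hmg : ∀ r, m (g r) = r := fun r => by
    simp only [m, hg, add_sub_cancel_right, inner_smul_right]
    field_simp
  have hgm : ∀ p ∈ range γ, g (m p) = p := fun p hp => by
    obtain ⟨r, rfl⟩ := hv p hp
    rw [vadd_eq_add, ← hg, hmg]
  have hm : Continuous m := by fun_prop
  obtain ⟨a, b, hab, hI⟩ := hγ.exists_image_eq_Icc hm (mem_range_self 0) (mem_range_self 1)
    fun h => hγ.zero_ne_one <| by
      rw [← hgm _ (mem_range_self 0), h, hgm _ (mem_range_self 1)]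
  refine ⟨g a, g b, fun h => hab.ne (by rw [← hmg a, h, hmg]), ?_⟩
  rw [← image_segment, segment_eq_Icc hab.le, ← hI, image_image]
  exact ((image_congr hgm).trans (image_id' _)).symm

/-! ### From near-identity affine maps to a one-parameter group. -/

/-- The deviation of an affine map from the identity, as a linear operator in homogeneous
coordinates. -/
noncomputable def affineDeviation (f : Plane →ᵃ[ℝ] Plane) : (Plane × ℝ) →L[ℝ] (Plane × ℝ) :=
  LinearMap.toContinuousLinearMap <|
    ((f.linear - LinearMap.id).comp (LinearMap.fst ℝ Plane ℝ) +
      (LinearMap.snd ℝ Plane ℝ).smulRight (f 0)).prod 0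

theorem affineDeviation_apply (f : Plane →ᵃ[ℝ] Plane) (p : Plane) (c : ℝ) :
    affineDeviation f (p, c) = (f.linear p - p + c • f 0, 0) := rfl

theorem affineDeviation_apply_one (f : Plane →ᵃ[ℝ] Plane) (p : Plane) :
    affineDeviation f (p, 1) = (f p - p, 0) := by
  have : f p = f.linear p + f 0 := congrFun f.decomp p
  rw [affineDeviation_apply, this, one_smul]
  congr 1; abel

theorem one_add_affineDeviation_pow_apply (f : Plane →ᵃ[ℝ] Plane) (n : ℕ) (p : Plane) :
    ((1 + affineDeviation f) ^ n) (p, 1) = (f^[n] p, 1) := by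
  induction n generalizing p with
  | zero => simp
  | succ n ih =>
    rw [pow_succ, mul_apply_eq_comp, Function.iterate_succ_apply, ← ih (f p)]
    congr 1
    simp [affineDeviation_apply_one]

theorem tendsto_norm_affineDeviation {f : ℕ → Plane →ᵃ[ℝ] Plane}
    (hlim : ∀ p, Tendsto (fun k => f k p) atTop (𝓝 p)) :
    Tendsto (fun k => ‖affineDeviation (f k)‖) atTop (𝓝 0) := by
  have hpt : ∀ X : Plane × ℝ, Tendsto (fun k => ‖affineDeviation (f k) X‖) atTop (𝓝 0) := by
    rintro ⟨p, c⟩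
    have h1 : Tendsto (fun k => f k p - f k 0 - p + c • f k 0) atTop
        (𝓝 (p - 0 - p + c • (0 : Plane))) :=
      (((hlim p).sub (hlim 0)).sub_const p).add ((hlim 0).const_smul c)
    have h2 : Tendsto (fun k => (f k p - f k 0 - p + c • f k 0, (0 : ℝ))) atTop
        (𝓝 (p - 0 - p + c • (0 : Plane), 0)) := h1.prodMk_nhds tendsto_const_nhds
    have h3 := h2.norm
    have e : ∀ k, (f k).linear p = f k p - f k 0 := fun k => by
      have : f k p = (f k).linear p + f k 0 := congrFun (f k).decomp p
      rw [this, add_sub_cancel_right]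
    simp only [affineDeviation_apply, e]
    simpa using h3
  obtain ⟨C, hC, hb⟩ := (Module.finBasis ℝ (Plane × ℝ)).exists_opNorm_le (F := Plane × ℝ)
  set b := Module.finBasis ℝ (Plane × ℝ)
  have hsum : Tendsto (fun k => C * ∑ i, ‖affineDeviation (f k) (b i)‖) atTop (𝓝 0) := by
    simpa using (tendsto_finsetSum _ fun i _ => hpt (b i)).const_mul C
  refine squeeze_zero (fun _ => norm_nonneg _) (fun k => ?_) hsum
  exact hb (Finset.sum_nonneg fun _ _ => norm_nonneg _) fun i =>
    Finset.single_le_sum (f := fun i => ‖affineDeviation (f k) (b i)‖)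
      (fun _ _ => norm_nonneg _) (Finset.mem_univ i)

theorem norm_affineMap_sub_self_le (f : Plane →ᵃ[ℝ] Plane) (p : Plane) :
    ‖f p - p‖ ≤ ‖affineDeviation f‖ * ‖((p, 1) : Plane × ℝ)‖ := by
  refine le_trans ?_ ((affineDeviation f).le_opNorm (p, 1))
  rw [affineDeviation_apply_one]
  exact norm_fst_le ((f p - p, (0 : ℝ)) : Plane × ℝ)

/-- If `f` identified `p` and `q`, its deviation would send `(p - q, 0)` to its negative. -/
theorem injective_of_norm_affineDeviation_lt_one {f : Plane →ᵃ[ℝ] Plane}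
    (h : ‖affineDeviation f‖ < 1) : Function.Injective f := by
  intro p q hpq
  by_contra hne
  have h1 : affineDeviation f (p - q, 0) = (-(p - q), 0) := by
    have : ((p - q, 0) : Plane × ℝ) = (p, 1) - (q, 1) := by simp
    rw [this, map_sub, affineDeviation_apply_one, affineDeviation_apply_one, hpq]
    ext <;> simp
  have h2 := (affineDeviation f).le_opNorm (p - q, 0)
  rw [h1] at h2
  have h3 : 0 < ‖p - q‖ := norm_pos_iff.2 (sub_ne_zero.2 hne)
  simp only [Prod.norm_mk, norm_neg, norm_zero, max_eq_left h3.le] at h2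
  nlinarith

/-- If maps close to the identity shift an arc along itself, then the arc contains forward pieces
of all orbits of a nontrivial one-parameter group of affine maps starting on it. -/
theorem IsJordanArc.exists_orbit_subset {γ : unitInterval → Plane} (hγ : IsJordanArc γ)
    {f : ℕ → Plane →ᵃ[ℝ] Plane} (hlim : ∀ p, Tendsto (fun k => f k p) atTop (𝓝 p))
    (hsub : ∀ k, IsSubarc γ (f k (γ 0)) (γ 1) (f k '' range γ ∩ range γ))
    (hfix : ∀ k, ∀ p ∈ range γ, f k p ≠ p) :
    ∃ A : (Plane × ℝ) →L[ℝ] (Plane × ℝ), A ≠ 0 ∧ (∀ X, (A X).2 = 0) ∧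
      ∀ p ∈ range γ, p ≠ γ 1 → ∃ τ > 0, ∀ t ∈ Icc (0 : ℝ) τ,
        (NormedSpace.exp (t • A) (p, 1)).1 ∈ range γ := by
  set E : ℕ → (Plane × ℝ) →L[ℝ] (Plane × ℝ) := fun k => affineDeviation (f k)
  have hE : ∀ k, E k ≠ 0 := fun k h => by
    have h1 := affineDeviation_apply_one (f k) (γ 0)
    rw [show affineDeviation (f k) = 0 from h] at h1
    exact hfix k _ (mem_range_self 0) (sub_eq_zero.1 (congrArg Prod.fst h1).symm)
  have hE0 : Tendsto (fun k => ‖E k‖) atTop (𝓝 0) := tendsto_norm_affineDeviation hlim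
  have : ProperSpace ((Plane × ℝ) →L[ℝ] (Plane × ℝ)) := FiniteDimensional.proper_real _
  obtain ⟨A, hA1, σ, hσ, hA⟩ := (isCompact_sphere
    (0 : (Plane × ℝ) →L[ℝ] (Plane × ℝ)) 1).tendsto_subseq (x := fun k => ‖E k‖⁻¹ • E k) fun k => by
      rw [mem_sphere_zero_iff_norm, norm_smul, norm_inv, norm_norm,
        inv_mul_cancel₀ (norm_ne_zero_iff.2 (hE k))]
  rw [mem_sphere_zero_iff_norm] at hA1
  refine ⟨A, fun h => by simp [h] at hA1, fun X => ?_, fun p hp hp1 => ?_⟩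
  · have h1 : Tendsto (fun k => ((‖E (σ k)‖⁻¹ • E (σ k)) X).2) atTop (𝓝 (A X).2) :=
      ((continuous_snd.comp
        (ContinuousLinearMap.apply ℝ (Plane × ℝ) X).continuous).tendsto A).comp hA
    refine tendsto_nhds_unique h1 (tendsto_const_nhds.congr fun k => ?_)
    simp [E, affineDeviation_apply (f (σ k)) X.1 X.2]
  set d : ℝ := dist p (γ 1) with hd
  have hdpos : 0 < d := dist_pos.2 hp1
  set N : ℝ := ‖((p, 1) : Plane × ℝ)‖ with hN
  have hN1 : 1 ≤ N := by simp [N, Prod.norm_mk]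
  obtain ⟨η, hη, hexit⟩ := hγ.exists_dist_lt_of_le (half_pos hdpos)
  obtain ⟨R, hR⟩ := hγ.isCompact_range.isBounded.exists_norm_le
  -- Up to time `τ` the iterates move less than `d / 2` from `p`, so they stay more than `d / 2`
  -- away from `γ 1`.
  obtain ⟨τ, hτ, hτd⟩ : ∃ τ > 0, (Real.exp τ - 1) * N < d / 2 := by
    have hc : Tendsto (fun τ : ℝ => (Real.exp τ - 1) * N) (𝓝[>] 0) (𝓝 0) := by
      have : Continuous fun τ : ℝ => (Real.exp τ - 1) * N := by fun_prop
      simpa using (this.tendsto 0).mono_left nhdsWithin_le_nhds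
    obtain ⟨τ, h1, h2⟩ := ((hc.eventually_lt_const (half_pos hdpos)).and self_mem_nhdsWithin).exists
    exact ⟨τ, h2, h1⟩
  refine ⟨τ, hτ, fun t ht => ?_⟩
  have hstay : ∀ᶠ k in atTop, ∀ n : ℕ, n * ‖E k‖ ≤ τ → (f k)^[n] p ∈ range γ := by
    have hsmall : Tendsto (fun k => ‖E k‖ * max R 1) atTop (𝓝 0) := by
      simpa using hE0.mul_const (max R 1)
    filter_upwards [hE0.eventually_lt_const one_pos, hsmall.eventually_lt_const hη] with k hk1 hkη n
    obtain ⟨z, hz, hle⟩ := hγ.exists_map_eq_one (AffineMap.continuous_of_finiteDimensional (f k))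
      (injective_of_norm_affineDeviation_lt_one hk1) (hsub k)
    have hzη : dist (γ z) (γ 1) < η := by
      rw [dist_comm, dist_eq_norm, ← hz]
      refine ((norm_affineMap_sub_self_le (f k) (γ z)).trans ?_).trans_lt hkη
      gcongr
      simp only [Prod.norm_mk, norm_one]
      exact max_le_max (hR _ (mem_range_self z)) le_rfl
    induction n with
    | zero => exact fun _ => hp
    | succ n ih =>
      intro hn
      push_cast at hn
      have hn' : n * ‖E k‖ ≤ τ := by linarith [norm_nonneg (E k)]
      obtain ⟨s, hs⟩ := ih hn'
      rw [Function.iterate_succ_apply', ← hs]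
      -- The point `γ z` sent to the end is itself within `η` of it. An iterate at or beyond `z`
      -- would thus be within `d / 2` of the end, and also within `d / 2` of `p`.
      refine hle s (le_of_not_ge fun hzs => ?_)
      have h1 := hexit z s hzs hzη
      have h2 : dist (γ s) p ≤ (Real.exp τ - 1) * N := by
        rw [dist_eq_norm, hs]
        have e : ((1 + E k) ^ n - 1) (p, 1) = ((f k)^[n] p - p, 0) := by
          rw [sub_apply, one_add_affineDeviation_pow_apply]
          simp
        calc ‖(f k)^[n] p - p‖ ≤ ‖((1 + E k) ^ n - 1) (p, 1)‖ := by
              rw [e]; exact norm_fst_le (((f k)^[n] p - p, (0 : ℝ)) : Plane × ℝ)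
          _ ≤ ‖(1 + E k) ^ n - 1‖ * N := ContinuousLinearMap.le_opNorm _ _
          _ ≤ _ := by
            gcongr
            refine (norm_one_add_pow_sub_one_le _ _).trans ?_
            gcongr
      have h3 := dist_triangle_left p (γ 1) (γ s)
      linarith
  have hconv := tendsto_one_add_pow_floor_exp (fun k => hE (σ k))
    (hE0.comp hσ.tendsto_atTop) hA hA1 ht.1
  have hconv' := ((continuous_fst.comp
    (ContinuousLinearMap.apply ℝ (Plane × ℝ) ((p, 1) : Plane × ℝ)).continuous).tendsto _).comp hconv
  refine hγ.isCompact_range.isClosed.mem_of_tendsto hconv' ?_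
  filter_upwards [hσ.tendsto_atTop.eventually hstay] with k hk
  have := hk ⌊t / ‖E (σ k)‖⌋₊ <| by
    have h1 : 0 < ‖E (σ k)‖ := norm_pos_iff.2 (hE _)
    refine le_trans ?_ ht.2
    rw [← le_div_iff₀ h1]
    exact Nat.floor_le (div_nonneg ht.1 h1.le)
  convert this using 1
  simp only [Function.comp, ContinuousLinearMap.apply_apply]
  rw [one_add_affineDeviation_pow_apply]

/-! ### Exact quadratic relations and parabolas. -/

/-- If linear functionals `φ k ≠ 0`, `ψ k` nearly satisfy `ψ k = φ k ^ 2` on a spanning set, then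
some quadratic relation of this form holds exactly. -/
theorem exists_eq_sq_of_approx {V : Type*} [NormedAddCommGroup V] [NormedSpace ℝ V]
    [FiniteDimensional ℝ V] {Γ : Set V} (hspan : Submodule.span ℝ Γ = ⊤) {φ ψ : ℕ → V →L[ℝ] ℝ}
    {η : ℕ → ℝ} (hφ : ∀ k, φ k ≠ 0) (hη : Tendsto η atTop (𝓝 0))
    (h : ∀ k, ∀ w ∈ Γ, |ψ k w - φ k w ^ 2| ≤ η k * φ k w ^ 2) :
    ∃ m R : V →L[ℝ] ℝ, m ≠ 0 ∧ ∀ w ∈ Γ, R w = m w ^ 2 := by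
  have : ProperSpace (V →L[ℝ] ℝ) := FiniteDimensional.proper_real _
  have hpos : ∀ k, ‖φ k‖ ≠ 0 := fun k => norm_ne_zero_iff.2 (hφ k)
  obtain ⟨m, hm1, σ, hσ, hm⟩ := (isCompact_sphere (0 : V →L[ℝ] ℝ) 1).tendsto_subseq
    (x := fun k => ‖φ k‖⁻¹ • φ k) fun k => by
      rw [mem_sphere_zero_iff_norm, norm_smul, norm_inv, norm_norm, inv_mul_cancel₀ (hpos k)]
  rw [mem_sphere_zero_iff_norm] at hm1
  set R : ℕ → V →L[ℝ] ℝ := fun k => (‖φ (σ k)‖⁻¹ ^ 2) • ψ (σ k) with hR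
  have hmw : ∀ w, Tendsto (fun k => ‖φ (σ k)‖⁻¹ * φ (σ k) w) atTop (𝓝 (m w)) := fun w =>
    ((ContinuousLinearMap.apply ℝ ℝ w).continuous.tendsto m).comp hm
  have hRΓ : ∀ w ∈ Γ, Tendsto (fun k => R k w) atTop (𝓝 (m w ^ 2)) := fun w hw => by
    have h1 : Tendsto (fun k => R k w - (‖φ (σ k)‖⁻¹ * φ (σ k) w) ^ 2) atTop (𝓝 0) := by
      have h2 : Tendsto (fun k => η (σ k) * (‖φ (σ k)‖⁻¹ * φ (σ k) w) ^ 2) atTop (𝓝 0) := by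
        simpa using (hη.comp hσ.tendsto_atTop).mul ((hmw w).pow 2)
      refine squeeze_zero_norm (fun k => ?_) h2
      have e : R k w - (‖φ (σ k)‖⁻¹ * φ (σ k) w) ^ 2 =
          ‖φ (σ k)‖⁻¹ ^ 2 * (ψ (σ k) w - φ (σ k) w ^ 2) := by
        simp only [hR, smul_apply, smul_eq_mul]; ring
      rw [e, norm_mul, Real.norm_of_nonneg (by positivity), Real.norm_eq_abs, mul_pow,
        mul_left_comm]
      gcongr
      exact h _ w hw
    simpa using h1.add ((hmw w).pow 2)
  -- No bound on `ψ k` is given: convergence on `Γ` passes to its span, the whole space.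
  have hlim : ∀ w, ∃ r, Tendsto (fun k => R k w) atTop (𝓝 r) := fun w => by
    have hw : w ∈ Submodule.span ℝ Γ := hspan ▸ Submodule.mem_top
    induction hw using Submodule.span_induction with
    | mem w hw => exact ⟨_, hRΓ w hw⟩
    | zero => exact ⟨0, by simp⟩
    | add x y _ _ hx hy =>
      obtain ⟨r, hr⟩ := hx
      obtain ⟨r', hr'⟩ := hy
      exact ⟨r + r', by simpa using hr.add hr'⟩
    | smul c x _ hx =>
      obtain ⟨r, hr⟩ := hx
      exact ⟨c * r, by simpa using hr.const_mul c⟩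
  choose r hr using hlim
  refine ⟨m, LinearMap.toContinuousLinearMap (linearMapOfTendsto r
    (fun k => (R k : V →ₗ[ℝ] ℝ)) (tendsto_pi_nhds.2 hr)), fun h => by simp [h] at hm1,
    fun w hw => tendsto_nhds_unique (hr w) (hRΓ w hw)⟩

theorem span_sub_eq_top_of_not_collinear {s : Set Plane} {p : Plane} (hp : p ∈ s)
    (h : ¬Collinear ℝ s) : Submodule.span ℝ ((fun q => q - p) '' s) = ⊤ := by
  have h1 : vectorSpan ℝ s = Submodule.span ℝ ((fun q => q - p) '' s) :=
    vectorSpan_eq_span_vsub_set_right ℝ hp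
  rw [← h1]
  rw [collinear_iff_finrank_le_one, not_le] at h
  refine Submodule.eq_top_of_finrank_eq (le_antisymm (Submodule.finrank_le _) ?_)
  rw [finrank_euclideanSpace_fin]
  exact h

theorem Collinear.of_injective_image {s : Set Plane} {S : Plane →ᵃ[ℝ] Plane}
    (hS : Function.Injective S) (h : Collinear ℝ (S '' s)) : Collinear ℝ s := by
  rw [collinear_iff_finrank_le_one] at h ⊢
  rwa [← AffineMap.map_vectorSpan, LinearEquiv.finrank_eq
    (Submodule.equivMapOfInjective S.linear (S.linear_injective_iff.2 hS) (vectorSpan ℝ s)).symm] at h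

/-- An arc on which the square of a linear functional agrees with a linear functional is an arc of a
parabola. -/
theorem IsJordanArc.isParabolicSegment {γ : unitInterval → Plane} (hγ : IsJordanArc γ)
    (hnc : ¬Collinear ℝ (range γ)) {m R : Plane →L[ℝ] ℝ} (hm : m ≠ 0)
    (h : ∀ q ∈ range γ, R (q - γ 0) = m (q - γ 0) ^ 2) : IsParabolicSegment (range γ) := by
  have hspan := span_sub_eq_top_of_not_collinear (mem_range_self 0) hnc
  obtain ⟨q₁, hq₁, hmq⟩ : ∃ q ∈ range γ, m (q - γ 0) ≠ 0 := by
    by_contra! hcon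
    refine hm (ContinuousLinearMap.coe_injective (LinearMap.ext_on (f := (m : Plane →ₗ[ℝ] ℝ))
      (g := ((0 : Plane →L[ℝ] ℝ) : Plane →ₗ[ℝ] ℝ)) hspan ?_))
    rintro _ ⟨q, hq, rfl⟩
    simpa using hcon q hq
  obtain ⟨a, b, hab, hI⟩ := hγ.exists_image_eq_Icc (m := fun q => m (q - γ 0)) (by fun_prop)
    hq₁ (mem_range_self 0) (by simpa using hmq)
  let L : Plane →ₗ[ℝ] Plane := (WithLp.linearEquiv 2 ℝ (Fin 2 → ℝ)).symm.toLinearMap ∘ₗ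
    LinearMap.pi ![(m : Plane →ₗ[ℝ] ℝ), (R : Plane →ₗ[ℝ] ℝ)]
  have hL : ∀ w, L w = !₂[m w, R w] := fun w => by
    ext i; fin_cases i <;> rfl
  -- A common kernel vector of `m` and `R` would make `R` a multiple of `m`. The relation would then
  -- leave `m` at most two values on the arc, whereas it fills an interval.
  have hLinj : Function.Injective L := by
    rw [← LinearMap.ker_eq_bot, LinearMap.ker_eq_bot']
    intro w hw
    rw [hL] at hw
    have hmw : m w = 0 := by simpa using congrArg (fun x : Plane => x 0) hw
    have hRw : R w = 0 := by simpa using congrArg (fun x : Plane => x 1) hw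
    by_contra hw0
    set w' := q₁ - γ 0
    have hli : LinearIndependent ℝ ![w, w'] := by
      rw [LinearIndependent.pair_iff]
      intro s t hst
      have ht : t = 0 := by
        have := congrArg m hst
        simpa [hmw, hmq] using this
      subst ht
      exact ⟨by simpa [hw0] using hst, rfl⟩
    have htop := hli.span_eq_top_of_card_eq_finrank' (by simp)
    have hRm : R = (R w' / m w') • m := by
      refine ContinuousLinearMap.coe_injective (LinearMap.ext_on_range (v := ![w, w']) htop ?_)
      intro i
      fin_cases i
      · simp [hmw, hRw]
      · simp [hmq]
    refine (Icc_infinite hab).mono ?_ (toFinite {0, R w' / m w'})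
    rw [← hI]
    rintro _ ⟨q, hq, rfl⟩
    have h1 := h q hq
    rw [hRm, smul_apply, smul_eq_mul] at h1
    have h2 : m (q - γ 0) * (m (q - γ 0) - R w' / m w') = 0 := by linarith
    simpa [sub_eq_zero] using h2
  let e := LinearEquiv.ofInjectiveEndo L hLinj
  have he : ∀ q ∈ range γ, e (q - γ 0) = !₂[m (q - γ 0), m (q - γ 0) ^ 2] := fun q hq => by
    rw [← h q hq]; exact hL _
  refine ⟨e.symm.toAffineEquiv.trans (AffineEquiv.constVAdd ℝ Plane (γ 0)), a, b, hab, ?_⟩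
  rw [← hI, image_image, image_image]
  refine ((image_congr fun q hq => ?_).trans (image_id' _)).symm
  rw [← he q hq]
  simp

/-! ### Parabolic approximation of a curved orbit. -/

/-- The determinant of two vectors of the plane, as a linear functional of the second one. -/
noncomputable def planeDet (u : Plane) : Plane →L[ℝ] ℝ :=
  u 0 • EuclideanSpace.proj 1 - u 1 • EuclideanSpace.proj 0

theorem planeDet_apply (u w : Plane) : planeDet u w = u 0 * w 1 - u 1 * w 0 := rfl

theorem abs_planeDet_le (u w : Plane) : |planeDet u w| ≤ 2 * ‖u‖ * ‖w‖ := by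
  have hu0 : |u 0| ≤ ‖u‖ := PiLp.norm_apply_le u 0
  have hu1 : |u 1| ≤ ‖u‖ := PiLp.norm_apply_le u 1
  have hw0 : |w 0| ≤ ‖w‖ := PiLp.norm_apply_le w 0
  have hw1 : |w 1| ≤ ‖w‖ := PiLp.norm_apply_le w 1
  rw [planeDet_apply]
  calc |u 0 * w 1 - u 1 * w 0| ≤ |u 0| * |w 1| + |u 1| * |w 0| := by
        rw [← abs_mul, ← abs_mul]; exact abs_sub _ _
    _ ≤ ‖u‖ * ‖w‖ + ‖u‖ * ‖w‖ := by gcongr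
    _ = _ := by ring

theorem exists_eq_smul_of_planeDet_eq_zero {u w : Plane} (hu : u ≠ 0) (h : planeDet u w = 0) :
    ∃ c : ℝ, w = c • u := by
  rw [planeDet_apply] at h
  by_cases h0 : u 0 = 0
  · have h1 : u 1 ≠ 0 := fun h1 => hu (by ext i; fin_cases i <;> simp [h0, h1])
    have hw0 : w 0 = 0 := by simpa [h0, h1] using h
    refine ⟨w 1 / u 1, ?_⟩
    ext i; fin_cases i <;> simp [h0, h1, hw0]
  · refine ⟨w 0 / u 0, ?_⟩
    ext i; fin_cases i
    · simp [h0]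
    · simp; field_simp; linarith

/-- In the frame given by velocity and acceleration, a short displacement along a curve satisfies
approximately the equation of a parabola. -/
theorem exists_frame_coordinates {v a : Plane} {D M C : ℝ} (hD : 0 < D) (hva : D ≤ |planeDet v a|)
    (hv : ‖v‖ ≤ M) (ha : ‖a‖ ≤ M) (hC : 0 ≤ C) :
    ∃ φ ψ : Plane →L[ℝ] ℝ, φ ≠ 0 ∧ ∀ (Δ : Plane) (s : ℝ),
      ‖Δ - s • v - (s ^ 2 / 2) • a‖ ≤ C * |s| ^ 3 →
      |φ Δ - s| ≤ 4 * M * C / D * |s| ^ 3 ∧ |ψ Δ - s ^ 2| ≤ 4 * M * C / D * |s| ^ 3 := by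
  have hM : 0 ≤ M := (norm_nonneg v).trans hv
  have hne : planeDet v a ≠ 0 := fun h => by rw [h, abs_zero] at hva; linarith
  have hpos : 0 < |planeDet v a| := abs_pos.2 hne
  have hself : ∀ u, planeDet u u = 0 := fun u => by rw [planeDet_apply]; ring
  have hanti : ∀ u w, planeDet u w = -planeDet w u := fun u w => by
    rw [planeDet_apply, planeDet_apply]; ring
  have hbound : ∀ u r : Plane, ∀ s : ℝ, ‖u‖ ≤ M → ‖r‖ ≤ C * |s| ^ 3 →
      2 * |planeDet u r| / |planeDet v a| ≤ 4 * M * C / D * |s| ^ 3 := fun u r s hu hr => by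
    have h1 : 2 * |planeDet u r| ≤ 4 * M * C * |s| ^ 3 := by
      calc 2 * |planeDet u r| ≤ 2 * (2 * ‖u‖ * ‖r‖) := by gcongr; exact abs_planeDet_le u r
        _ ≤ 2 * (2 * M * (C * |s| ^ 3)) := by gcongr
        _ = _ := by ring
    calc _ ≤ 4 * M * C * |s| ^ 3 / D := by gcongr
      _ = _ := by ring
  -- Cramer's rule: `φ` is the `v`-coordinate and `ψ` twice the `a`-coordinate in the frame `(v,
  -- a)`.
  refine ⟨-(planeDet v a)⁻¹ • planeDet a, (2 * (planeDet v a)⁻¹) • planeDet v, fun h => ?_,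
    fun Δ s hΔ => ?_⟩
  · have h1 := congrArg (fun F : Plane →L[ℝ] ℝ => F v) h
    simp [hanti a v, hne] at h1
  · set r := Δ - s • v - (s ^ 2 / 2) • a with hr
    have hΔr : Δ = s • v + (s ^ 2 / 2) • a + r := by rw [hr]; abel
    rw [hΔr]
    constructor
    · have e : (-(planeDet v a)⁻¹ • planeDet a) (s • v + (s ^ 2 / 2) • a + r) - s =
          -(planeDet v a)⁻¹ * planeDet a r := by
        simp only [smul_apply, map_add, map_smul, smul_eq_mul, hself, hanti a v]
        field_simp; ring
      rw [e, abs_mul, abs_neg, abs_inv, inv_mul_eq_div]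
      refine le_trans ?_ (hbound a r s ha hΔ)
      gcongr
      linarith [abs_nonneg (planeDet a r)]
    · have e : ((2 * (planeDet v a)⁻¹) • planeDet v) (s • v + (s ^ 2 / 2) • a + r) - s ^ 2 =
          2 * planeDet v r / planeDet v a := by
        simp only [smul_apply, map_add, map_smul, smul_eq_mul, hself]
        field_simp; ring
      rw [e, abs_div, abs_mul, abs_two]
      exact hbound v r s hv hΔ

/-- Since `|x| ≥ |s| / 2`, the cubic error is at most a multiple of `h * x ^ 2`. A relative error is
essential: it survives rescaling by `‖φ‖⁻²`, however small the affine copy is. -/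
theorem abs_sub_sq_le_of_approx {x y s K h : ℝ} (hK : 0 ≤ K) (hs : |s| ≤ h) (hh : h ≤ 1)
    (hKh : K * h ≤ 1 / 2) (hx : |x - s| ≤ K * |s| ^ 3) (hy : |y - s ^ 2| ≤ K * |s| ^ 3) :
    |y - x ^ 2| ≤ 16 * K * h * x ^ 2 := by
  have h0 : 0 ≤ |s| := abs_nonneg s
  have hs1 : |s| ≤ 1 := hs.trans hh
  have hKs : K * |s| ≤ 1 / 2 := (mul_le_mul_of_nonneg_left hs hK).trans hKh
  have hx1 : |x - s| ≤ |s| / 2 := by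
    calc _ ≤ K * |s| ^ 3 := hx
      _ = (K * |s|) * |s| * |s| := by ring
      _ ≤ 1 / 2 * 1 * |s| := by gcongr
      _ = _ := by ring
  have hxs : |s| / 2 ≤ |x| := by
    have := abs_sub_abs_le_abs_sub s x
    rw [abs_sub_comm] at this
    linarith
  have hsq : |s| ^ 2 ≤ 4 * x ^ 2 := by
    rw [← sq_abs x]; nlinarith
  have hsum : |x + s| ≤ 5 / 2 * |s| := by
    have : x + s = (x - s) + 2 * s := by ring
    rw [this]
    refine (abs_add_le _ _).trans ?_
    rw [abs_mul, abs_two]; linarith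
  have h1 : |x ^ 2 - s ^ 2| ≤ 5 / 2 * (K * |s| ^ 3) := by
    have : x ^ 2 - s ^ 2 = (x - s) * (x + s) := by ring
    rw [this, abs_mul]
    calc _ ≤ K * |s| ^ 3 * (5 / 2 * |s|) := by gcongr
      _ ≤ K * |s| ^ 3 * (5 / 2 * 1) := by gcongr
      _ = _ := by ring
  have h2 : |y - x ^ 2| ≤ 4 * (K * |s| ^ 3) := by
    have : y - x ^ 2 = (y - s ^ 2) - (x ^ 2 - s ^ 2) := by ring
    rw [this]
    refine (abs_sub _ _).trans ?_
    have : 0 ≤ K * |s| ^ 3 := by positivity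
    linarith
  calc _ ≤ 4 * (K * |s| ^ 3) := h2
    _ = 4 * K * |s| * |s| ^ 2 := by ring
    _ ≤ 4 * K * h * (4 * x ^ 2) := by
        have := h0.trans hs
        gcongr
    _ = _ := by ring

/-- If arbitrarily small affine copies of an arc fit into a curve with nonvanishing curvature, then
the arc is an arc of a parabola or collinear. -/
theorem IsJordanArc.exists_eq_sq {γ : unitInterval → Plane} (hγ : IsJordanArc γ)
    (hsmall : ∀ (x y : Plane) (B : Set Plane), x ≠ y → IsSubarc γ x y B →
      ∃ S : Plane →ᵃ[ℝ] Plane, Function.Injective S ∧ S '' range γ ⊆ B)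
    (hnc : ¬Collinear ℝ (range γ)) {P v a : ℝ → Plane} (hP : Continuous P) (hv : Continuous v)
    (ha : Continuous a) {τ δ C : ℝ} (hτ : 0 < τ) (hδ : 0 < δ) (hC : 0 ≤ C)
    (hPγ : ∀ t ∈ Icc 0 τ, P t ∈ range γ) (hdet : planeDet (v 0) (a 0) ≠ 0)
    (hnonconst : ∀ h > 0, ∃ t ∈ Icc 0 h, P t ≠ P 0)
    (hexp : ∀ t ∈ Icc 0 τ, ∀ s, |s| ≤ δ →
      ‖P (t + s) - P t - s • v t - (s ^ 2 / 2) • a t‖ ≤ C * |s| ^ 3) :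
    ∃ m R : Plane →L[ℝ] ℝ, m ≠ 0 ∧ ∀ q ∈ range γ, R (q - γ 0) = m (q - γ 0) ^ 2 := by
  have hdetc : Continuous fun t => |planeDet (v t) (a t)| := by
    simp only [planeDet_apply]; fun_prop
  have hpos : 0 < |planeDet (v 0) (a 0)| := abs_pos.2 hdet
  obtain ⟨ρ, hρ, hρdet⟩ := Metric.eventually_nhds_iff.1
    ((hdetc.tendsto 0).eventually_const_le (half_lt_self hpos))
  obtain ⟨M, hM⟩ := (isCompact_Icc (a := (0 : ℝ)) (b := τ)).exists_bound_of_continuousOn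
    (f := fun t => (v t, a t)) (by fun_prop)
  set K := 4 * M * C / (|planeDet (v 0) (a 0)| / 2) with hK
  have hM0 : 0 ≤ M := (norm_nonneg _).trans (hM 0 ⟨le_rfl, hτ.le⟩)
  have hK0 : 0 ≤ K := by positivity
  obtain ⟨h₀, hh₀, hh1, hhτ, hhδ, hhρ, hhK⟩ : ∃ h₀ : ℝ, 0 < h₀ ∧ h₀ ≤ 1 ∧ h₀ ≤ τ ∧ h₀ ≤ δ ∧
      h₀ < ρ ∧ K * h₀ ≤ 1 / 2 := by
    have hlim : Tendsto (fun h : ℝ => K * h) (𝓝[>] 0) (𝓝 0) := by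
      have : Continuous fun h : ℝ => K * h := by fun_prop
      simpa using (this.tendsto 0).mono_left nhdsWithin_le_nhds
    have hid : Tendsto (fun h : ℝ => h) (𝓝[>] 0) (𝓝 0) := nhdsWithin_le_nhds
    obtain ⟨h, h1⟩ := (eventually_mem_nhdsWithin.and ((hid.eventually_le_const one_pos).and
      ((hid.eventually_le_const hτ).and ((hid.eventually_le_const hδ).and
      ((hid.eventually_lt_const hρ).and
        (hlim.eventually_le_const (half_pos one_pos))))))).exists
    exact ⟨h, h1⟩
  have step : ∀ h, 0 < h → h ≤ h₀ → ∃ φ ψ : Plane →L[ℝ] ℝ, φ ≠ 0 ∧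
      ∀ w ∈ (fun q => q - γ 0) '' range γ, |ψ w - φ w ^ 2| ≤ 16 * K * h * φ w ^ 2 := by
    intro h hh hle
    obtain ⟨t', ht', hne⟩ := hnonconst h hh
    obtain ⟨x, y, B, hxy, hB, hBsub⟩ := hγ.exists_isSubarc_subset
      (isPreconnected_Icc.image P hP.continuousOn)
      (image_subset_iff.2 fun t (ht : t ∈ Icc 0 h) => hPγ t ⟨ht.1, by linarith [ht.2]⟩)
      (mem_image_of_mem P ht') (mem_image_of_mem P (left_mem_Icc.2 hh.le)) hne
    obtain ⟨S, hS, hSB⟩ := hsmall x y B hxy hB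
    have hSP : ∀ q ∈ range γ, ∃ t ∈ Icc 0 h, P t = S q := fun q hq =>
      hBsub (hSB (mem_image_of_mem S hq))
    -- Expanding at the time `t₀` of `S (γ 0)` makes displacements along the orbit images of `q - γ
    -- 0` under the linear part of `S`.
    obtain ⟨t₀, ht₀, hPt₀⟩ := hSP _ (mem_range_self 0)
    have ht₀τ : t₀ ∈ Icc 0 τ := ⟨ht₀.1, by linarith [ht₀.2]⟩
    have hMt := hM t₀ ht₀τ
    obtain ⟨φ, ψ, hφ, hφψ⟩ := exists_frame_coordinates (half_pos hpos)
      (hρdet (y := t₀) (by rw [Real.dist_eq, sub_zero, abs_of_nonneg ht₀.1]; linarith [ht₀.2]))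
      ((norm_fst_le (v t₀, a t₀)).trans hMt) ((norm_snd_le (v t₀, a t₀)).trans hMt) hC
    let Λ : Plane →L[ℝ] Plane := LinearMap.toContinuousLinearMap S.linear
    have hΛ : Function.Surjective Λ :=
      LinearMap.injective_iff_surjective.1 (S.linear_injective_iff.2 hS)
    refine ⟨φ.comp Λ, ψ.comp Λ, fun h0 => hφ ?_, ?_⟩
    · ext1 w
      obtain ⟨w, rfl⟩ := hΛ w
      exact congrArg (fun F : Plane →L[ℝ] ℝ => F w) h0
    · rintro _ ⟨q, hq, rfl⟩
      obtain ⟨t, ht, hPt⟩ := hSP q hq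
      have hs : |t - t₀| ≤ h := abs_sub_le_iff.2 ⟨by linarith [ht.2, ht₀.1], by linarith [ht₀.2, ht.1]⟩
      have e : Λ (q - γ 0) = P t - P t₀ := by
        rw [hPt, hPt₀]; exact S.linearMap_vsub q (γ 0)
      have h1 := hexp t₀ ht₀τ (t - t₀) (by linarith)
      rw [add_sub_cancel, ← e] at h1
      obtain ⟨h2, h3⟩ := hφψ _ _ h1
      exact abs_sub_sq_le_of_approx hK0 hs (by linarith)
        ((mul_le_mul_of_nonneg_left hle hK0).trans hhK) h2 h3
  choose φ ψ hφ hφψ using fun k : ℕ => step (h₀ / (k + 1)) (by positivity)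
    (div_le_self hh₀.le (by linarith [k.cast_nonneg (α := ℝ)]))
  obtain ⟨m, R, hm, hR⟩ := exists_eq_sq_of_approx
    (span_sub_eq_top_of_not_collinear (mem_range_self 0) hnc) hφ (by
      have := (tendsto_one_div_add_atTop_nhds_zero_nat (𝕜 := ℝ)).const_mul (16 * K * h₀)
      rw [mul_zero] at this
      refine this.congr fun k => ?_
      rw [mul_assoc, mul_one_div]) hφψ
  exact ⟨m, R, hm, fun q hq => hR _ (mem_image_of_mem _ hq)⟩

/-! ### Orbits of one-parameter affine groups. -/

section BanachAlgebra

variable {W : Type*} [NormedRing W] [NormedAlgebra ℝ W] (A : W)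

theorem exp_zero_smul : NormedSpace.exp ((0 : ℝ) • A) = 1 := by
  rw [zero_smul, NormedSpace.exp_zero]

variable [CompleteSpace W]

theorem continuous_exp_smul : Continuous fun t : ℝ => NormedSpace.exp (t • A) := by
  let _ : NormedAlgebra ℚ W := NormedAlgebra.restrictScalars ℚ ℝ W
  exact NormedSpace.exp_continuous.comp (by fun_prop)

theorem exp_add_smul (t s : ℝ) :
    NormedSpace.exp ((t + s) • A) = NormedSpace.exp (s • A) * NormedSpace.exp (t • A) := by
  let _ : NormedAlgebra ℚ W := NormedAlgebra.restrictScalars ℚ ℝ W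
  rw [add_comm, add_smul, NormedSpace.exp_add_of_commute]
  exact ((Commute.refl A).smul_left s).smul_right t

theorem hasDerivAt_exp_smul_zero :
    HasDerivAt (fun t : ℝ => NormedSpace.exp (t • A)) A 0 := by
  simpa using hasDerivAt_exp_smul_const (𝕂 := ℝ) A 0

end BanachAlgebra

/-- A closed subspace invariant under an operator is invariant under its exponential. -/
theorem exp_apply_mem_of_invariant {V : Type*} [NormedAddCommGroup V] [NormedSpace ℝ V]
    [FiniteDimensional ℝ V] {A : V →L[ℝ] V} {U : Submodule ℝ V} (hU : ∀ X ∈ U, A X ∈ U) (t : ℝ)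
    {X : V} (hX : X ∈ U) : NormedSpace.exp (t • A) X ∈ U := by
  have hpow : ∀ n : ℕ, (A ^ n) X ∈ U := fun n => by
    induction n with
    | zero => simpa using hX
    | succ n ih => rw [pow_succ', mul_apply_eq_comp]; exact hU _ ih
  have : CompleteSpace V := FiniteDimensional.complete ℝ V
  have hs := (NormedSpace.exp_series_hasSum_exp' (𝕂 := ℝ) (t • A)).mapL
    (ContinuousLinearMap.apply ℝ V X)
  refine U.closed_of_finiteDimensional.mem_of_tendsto hs (Eventually.of_forall fun F => ?_)
  refine U.sum_mem fun n _ => ?_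
  rw [smul_pow]
  exact U.smul_mem _ (U.smul_mem _ (hpow n))

/-- If velocity and acceleration of an orbit are parallel, then the orbit lies on a line. -/
theorem collinear_orbit {A : (Plane × ℝ) →L[ℝ] (Plane × ℝ)} (hA2 : ∀ X, (A X).2 = 0) {p : Plane}
    {c : ℝ} (hc : A (A (p, 1)) = c • A (p, 1)) (s : Set ℝ) :
    Collinear ℝ ((fun t : ℝ => (NormedSpace.exp (t • A) (p, 1)).1) '' s) := by
  rw [collinear_iff_exists_forall_eq_smul_vadd]
  refine ⟨p, (A (p, 1)).1, ?_⟩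
  rintro _ ⟨t, -, rfl⟩
  -- As `A` maps `A (p, 1)` to a multiple of itself, this span is invariant and contains the orbit;
  -- the last coordinate, always `1`, then fixes the coefficient of `(p, 1)`.
  have hU : ∀ X ∈ Submodule.span ℝ {((p, 1) : Plane × ℝ), A (p, 1)},
      A X ∈ Submodule.span ℝ {((p, 1) : Plane × ℝ), A (p, 1)} := fun X hX => by
    obtain ⟨x, y, rfl⟩ := Submodule.mem_span_pair.1 hX
    rw [map_add, map_smul, map_smul, hc]
    exact Submodule.mem_span_pair.2 ⟨0, x + y * c, by rw [zero_smul, zero_add, add_smul, mul_smul]⟩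
  have hmem := exp_apply_mem_of_invariant hU t
    (Submodule.subset_span (mem_insert (p, 1) {A (p, 1)}))
  obtain ⟨x, y, hxy⟩ := Submodule.mem_span_pair.1 hmem
  have hexp2 : (NormedSpace.exp (t • A) (p, 1)).2 = 1 := by
    have hs := ((NormedSpace.exp_series_hasSum_exp' (𝕂 := ℝ) (t • A)).mapL
      (ContinuousLinearMap.apply ℝ (Plane × ℝ) ((p, 1) : Plane × ℝ))).mapL
      (ContinuousLinearMap.snd ℝ Plane ℝ)
    refine hs.unique ?_
    convert hasSum_single (0 : ℕ) (fun n hn => ?_) using 1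
    · simp
    · obtain ⟨n, rfl⟩ := Nat.exists_eq_succ_of_ne_zero hn
      simp [pow_succ', hA2]
  rw [← hxy] at hexp2
  have hx : x = 1 := by simpa [hA2] using hexp2
  refine ⟨y, ?_⟩
  beta_reduce
  rw [← hxy, hx, vadd_eq_add]
  simp [add_comm]

/-- An orbit constant on `[0, h]` would have zero one-sided derivative at `0`, but that derivative
is `(A X).1`. -/
theorem exists_exp_apply_ne {A : (Plane × ℝ) →L[ℝ] (Plane × ℝ)} {X : Plane × ℝ}
    (hAX : (A X).1 ≠ 0) {h : ℝ} (hh : 0 < h) :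
    ∃ t ∈ Icc 0 h, (NormedSpace.exp (t • A) X).1 ≠ X.1 := by
  by_contra! hcon
  have h1 : HasDerivAt (fun t : ℝ => (NormedSpace.exp (t • A) X).1) (A X).1 0 := by
    exact ((ContinuousLinearMap.fst ℝ Plane ℝ).comp
      (ContinuousLinearMap.apply ℝ (Plane × ℝ) X)).hasFDerivAt.comp_hasDerivAt 0
      (hasDerivAt_exp_smul_zero A)
  have h0 : (0 : ℝ) ∈ Icc 0 h := ⟨le_rfl, hh.le⟩
  have h3 : HasDerivWithinAt (fun t : ℝ => (NormedSpace.exp (t • A) X).1) 0 (Icc 0 h) 0 :=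
    (hasDerivWithinAt_const 0 (Icc 0 h) X.1).congr hcon (hcon 0 h0)
  exact hAX (((uniqueDiffOn_Icc hh) 0 h0).eq_deriv _ h1.hasDerivWithinAt h3)

/-- Three non-collinear points, lifted to height `1`, span the homogeneous space. -/
theorem eq_zero_of_forall_apply_eq_zero {s : Set Plane} {p : Plane} (hp : p ∈ s)
    (hs : ¬Collinear ℝ s) {A : (Plane × ℝ) →L[ℝ] (Plane × ℝ)}
    (h : ∀ q ∈ s, A (q, 1) = 0) : A = 0 := by
  have h1 : ∀ w : Plane, A (w, 0) = 0 := fun w => by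
    have hw : w ∈ Submodule.span ℝ ((fun q => q - p) '' s) :=
      span_sub_eq_top_of_not_collinear hp hs ▸ Submodule.mem_top
    have hle : Submodule.span ℝ ((fun q => q - p) '' s) ≤
        LinearMap.ker ((A : (Plane × ℝ) →ₗ[ℝ] (Plane × ℝ)) ∘ₗ LinearMap.inl ℝ Plane ℝ) := by
      rw [Submodule.span_le]
      rintro _ ⟨q, hq, rfl⟩
      have e : ((q - p, 0) : Plane × ℝ) = (q, 1) - (p, 1) := by simp
      change A (q - p, 0) = 0
      rw [e, map_sub, h q hq, h p hp, sub_zero]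
    exact hle hw
  refine ContinuousLinearMap.ext fun X => ?_
  have e : X = (X.1 - X.2 • p, 0) + X.2 • (p, 1) := by ext <;> simp
  rw [e, map_add, map_smul, h1, h p hp]
  simp

theorem IsJordanArc.apply_eq_zero_of_ne_one {γ : unitInterval → Plane} (hγ : IsJordanArc γ)
    {A : (Plane × ℝ) →L[ℝ] (Plane × ℝ)} (h : ∀ q ∈ range γ, q ≠ γ 1 → A (q, 1) = 0) :
    ∀ q ∈ range γ, A (q, 1) = 0 := by
  have hc := hγ.continuous
  have h1 : (fun s => A (γ s, 1)) = fun _ => 0 :=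
    Continuous.ext_on (dense_compl_singleton (1 : unitInterval)) (by fun_prop) (by fun_prop)
      fun s hs => h _ (mem_range_self s) fun e => hs (hγ.injective e)
  rintro _ ⟨s, rfl⟩
  exact congrFun h1 s

/-! ### Combining orbits with self-affinity. -/

/-- An arc that contains affine copies of itself in all its subarcs, and that contains pieces of
orbits of a nontrivial one-parameter affine group, is collinear or an arc of a parabola. -/
theorem IsJordanArc.collinear_or_exists_eq_sq {γ : unitInterval → Plane} (hγ : IsJordanArc γ)
    (hsmall : ∀ (x y : Plane) (B : Set Plane), x ≠ y → IsSubarc γ x y B →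
      ∃ S : Plane →ᵃ[ℝ] Plane, Function.Injective S ∧ S '' range γ ⊆ B)
    {A : (Plane × ℝ) →L[ℝ] (Plane × ℝ)} (hA : A ≠ 0) (hA2 : ∀ X, (A X).2 = 0)
    (horb : ∀ p ∈ range γ, p ≠ γ 1 → ∃ τ > 0, ∀ t ∈ Icc (0 : ℝ) τ,
        (NormedSpace.exp (t • A) (p, 1)).1 ∈ range γ) :
    Collinear ℝ (range γ) ∨
      ∃ m R : Plane →L[ℝ] ℝ, m ≠ 0 ∧ ∀ q ∈ range γ, R (q - γ 0) = m (q - γ 0) ^ 2 := by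
  refine or_iff_not_imp_left.2 fun hnc => ?_
  obtain ⟨p, hp, hp1, hAp⟩ : ∃ p ∈ range γ, p ≠ γ 1 ∧ A (p, 1) ≠ 0 := by
    by_contra! hcon
    exact hA (eq_zero_of_forall_apply_eq_zero (mem_range_self 0) hnc
      (hγ.apply_eq_zero_of_ne_one hcon))
  have hv0 : (A (p, 1)).1 ≠ 0 := fun h => hAp (Prod.ext h (hA2 _))
  obtain ⟨τ, hτ, hγτ⟩ := horb p hp hp1
  set X : ℝ → Plane × ℝ := fun t => NormedSpace.exp (t • A) (p, 1) with hX
  have hexpc : Continuous fun t : ℝ => NormedSpace.exp (t • A) := continuous_exp_smul A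
  have hXc : Continuous X := by fun_prop
  have hX0 : X 0 = (p, 1) := by
    change NormedSpace.exp ((0 : ℝ) • A) (p, 1) = (p, 1)
    rw [show NormedSpace.exp ((0 : ℝ) • A) = 1 from exp_zero_smul A, one_apply_eq_self]
  have hne : ∀ h > 0, ∃ t ∈ Icc 0 h, (X t).1 ≠ (X 0).1 := fun h hh => by
    rw [hX0]; exact exists_exp_apply_ne hv0 hh
  by_cases hdet : planeDet (A (X 0)).1 (A (A (X 0))).1 = 0
  · exfalso
    rw [hX0] at hdet
    obtain ⟨c, hc⟩ := exists_eq_smul_of_planeDet_eq_zero hv0 hdet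
    have hcol := collinear_orbit hA2 (c := c) (p := p)
      (Prod.ext (by simpa using hc) (by simp [hA2])) (Icc 0 τ)
    obtain ⟨t, ht, hXt⟩ := hne τ hτ
    obtain ⟨x, y, B, hxy, hB, hBsub⟩ := hγ.exists_isSubarc_subset
      (isPreconnected_Icc.image (fun t => (X t).1) (by fun_prop))
      (image_subset_iff.2 hγτ) (mem_image_of_mem _ ht)
      (mem_image_of_mem _ (left_mem_Icc.2 hτ.le)) hXt
    obtain ⟨S, hS, hSB⟩ := hsmall x y B hxy hB
    exact hnc ((hcol.subset (hSB.trans hBsub)).of_injective_image hS)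
  obtain ⟨C, δ, hC, hδ, hexp⟩ := exists_norm_exp_smul_sub_le A
  obtain ⟨M, hM⟩ := (isCompact_Icc (a := (0 : ℝ)) (b := τ)).exists_bound_of_continuousOn
    (f := X) hXc.continuousOn
  have hM0 : 0 ≤ M := (norm_nonneg _).trans (hM 0 ⟨le_rfl, hτ.le⟩)
  refine hγ.exists_eq_sq hsmall hnc (P := fun t => (X t).1) (v := fun t => (A (X t)).1)
    (a := fun t => (A (A (X t))).1) (by fun_prop) (by fun_prop) (by fun_prop) hτ hδ
    (C := C * M) (by positivity) hγτ hdet hne fun t ht s hs => ?_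
  have hadd : X (t + s) = NormedSpace.exp (s • A) (X t) :=
    congrArg (fun B : (Plane × ℝ) →L[ℝ] (Plane × ℝ) => B (p, 1)) (exp_add_smul A t s)
  set Q : (Plane × ℝ) →L[ℝ] (Plane × ℝ) :=
    NormedSpace.exp (s • A) - (1 + s • A + (s ^ 2 / 2) • A ^ 2) with hQ
  have e : (X (t + s)).1 - (X t).1 - s • (A (X t)).1 - (s ^ 2 / 2) • (A (A (X t))).1 =
      (Q (X t)).1 := by
    rw [hadd]
    simp [hQ, pow_two]
    abel
  calc _ ≤ ‖Q (X t)‖ := by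
        rw [e]; exact norm_fst_le _
    _ ≤ ‖Q‖ * ‖X t‖ :=
        ContinuousLinearMap.le_opNorm _ _
    _ ≤ C * |s| ^ 3 * M := by
        gcongr
        exacts [hexp s hs, hM t ht]
    _ = _ := by ring

theorem theorem2 (γ : unitInterval → Plane) (hγ : IsJordanArc γ)
    (h_small : ∀ ε : ℝ, 0 < ε → ∀ (x y : Plane) (B : Set Plane), x ≠ y → IsSubarc γ x y B →
      ∃ S : Plane →ᵃ[ℝ] Plane, Function.Injective S ∧ S '' Set.range γ ⊆ B ∧
        ∃ K : NNReal, (K : ℝ) < ε ∧ LipschitzWith K S)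
    (h_shift : ∃ f : ℕ → (Plane →ᵃ[ℝ] Plane),
      (∀ p : Plane, Filter.Tendsto (fun k => f k p) Filter.atTop (nhds p)) ∧
      ∀ k : ℕ, IsSubarc γ (f k (γ 0)) (γ 1) (f k '' Set.range γ ∩ Set.range γ) ∧
        ∀ p ∈ Set.range γ, f k p ≠ p) :
    IsParabolicSegment (Set.range γ) ∨ IsStraightSegment (Set.range γ) := by
  obtain ⟨f, hlim, hf⟩ := h_shift
  obtain ⟨A, hA, hA2, horb⟩ := hγ.exists_orbit_subset hlim (fun k => (hf k).1) fun k => (hf k).2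
  by_cases hcol : Collinear ℝ (range γ)
  · exact Or.inr (hγ.isStraightSegment hcol)
  obtain ⟨m, R, hm, h⟩ := (hγ.collinear_or_exists_eq_sq (fun x y B hxy hB => by
    -- The value `1` is arbitrary: the copy only has to fit into the subarc.
    obtain ⟨S, hS, hSB, -⟩ := h_small 1 one_pos x y B hxy hB
    exact ⟨S, hS, hSB⟩) hA hA2 horb).resolve_left hcol
  exact Or.inl (hγ.isParabolicSegment hcol hm h)
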